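/- Let $k$ be a commutative ring and let $A$ be an associative unital $k$-algebra. An $A$-coring is an $A$-bimodule $C$ (on which $k$ acts centrally through $A$) together with $A$-bimodule maps $\Delta : C \to C\otimes_A C$ and $\epsilon : C \to A$ such that $(C\otimes_A\Delta)\Delta = (\Delta\otimes_A C)\Delta$ and, up to the canonical isomorphisms $C\otimes_A A\cong C\cong A\otimes_A C$, $(C\otimes_A\epsilon)\Delta = \mathrm{id}_C = (\epsilon\otimes_A C)\Delta$. A $C$-bicomodule is an $A$-bimodule $M$ with coassociative and counital coactions $\rho_M : M\to M\otimes_A C$ and $\lambda_M : M\to C\otimes_A M$ that are $A$-bimodule maps and satisfy $(C\otimes_A\rho_M)\lambda_M=(\lambda_M\otimes_A C)\rho_M$; in particular $C$ is a $C$-bicomodule via $\rho_C=\lambda_C=\Delta$. A subbicomodule of $C$ is an $A$-subbimodule $D\subseteq C$ that carries a $C$-bicomodule structure for which the inclusion $D\to C$ commutes with both coactions. An $A$-bimodule $M$ is of finite type if $M=\sum_i A m_i A$ for finitely many $m_i\in M$. The coring $C$ is simple if it has no subbicomodules other than $0$ and $C$. Let $C$ be an $A$-coring that is projective as a left $A$-module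 and projective as a right $A$-module. Then: 1. $C=\bigcup_i C_i$ for some family of subbicomodules $C_i$ of $C$, each of which is of finite type as an $A$-bimodule. 2. If $C$ is simple, then $C$ is of finite type as an $A$-bimodule. -/

import Mathlib

open scoped TensorProduct

namespace CoringTheory

section Tensor

/-- The defining relations `(m · a) ⊗ n = m ⊗ (a · n)` of the tensor product over `A`.
A right `A`-module is a module over `Aᵐᵒᵖ`, so that `m · a` is `MulOpposite.op a • m`. -/
def tensorRel (A M N : Type*) [Ring A] [AddCommGroup M] [Module Aᵐᵒᵖ M]
    [AddCommGroup N] [Module A N] : AddSubgroup (M ⊗[ℤ] N) :=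
  AddSubgroup.closure {t | ∃ (m : M) (a : A) (n : N),
    t = (MulOpposite.op a • m) ⊗ₜ[ℤ] n - m ⊗ₜ[ℤ] (a • n)}

/-- The tensor product `M ⊗_A N` of a right `A`-module `M` and a left `A`-module `N` over an
arbitrary (not necessarily commutative) ring `A`. -/
def Tensor (A M N : Type*) [Ring A] [AddCommGroup M] [Module Aᵐᵒᵖ M]
    [AddCommGroup N] [Module A N] : Type _ :=
  (M ⊗[ℤ] N) ⧸ tensorRel A M N

variable {A M N P M' N' : Type*} [Ring A]
  [AddCommGroup M] [AddCommGroup N] [AddCommGroup P] [AddCommGroup M'] [AddCommGroup N']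

instance [Module Aᵐᵒᵖ M] [Module A N] : AddCommGroup (Tensor A M N) :=
  inferInstanceAs (AddCommGroup ((M ⊗[ℤ] N) ⧸ tensorRel A M N))

variable [Module Aᵐᵒᵖ M] [Module A N] [Module Aᵐᵒᵖ M'] [Module A N']

namespace Tensor

/-- The quotient map onto `M ⊗_A N`. -/
def mkQ (A M N : Type*) [Ring A] [AddCommGroup M] [AddCommGroup N]
    [Module Aᵐᵒᵖ M] [Module A N] : M ⊗[ℤ] N →+ Tensor A M N :=
  QuotientAddGroup.mk' (tensorRel A M N)

/-- The pure tensor `m ⊗ n` in `M ⊗_A N`. -/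
def tmul (A : Type*) [Ring A] [Module Aᵐᵒᵖ M] [Module A N] (m : M) (n : N) : Tensor A M N :=
  mkQ A M N (m ⊗ₜ[ℤ] n)

theorem add_tmul (m m' : M) (n : N) : tmul A (m + m') n = tmul A m n + tmul A m' n := by
  rw [tmul, TensorProduct.add_tmul, map_add]; rfl

theorem tmul_add (m : M) (n n' : N) : tmul A m (n + n') = tmul A m n + tmul A m n' := by
  rw [tmul, TensorProduct.tmul_add, map_add]; rfl

theorem smul_tmul (m : M) (a : A) (n : N) :
    tmul A (MulOpposite.op a • m) n = tmul A m (a • n) := by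
  have h : mkQ A M N ((MulOpposite.op a • m) ⊗ₜ[ℤ] n - m ⊗ₜ[ℤ] (a • n)) = 0 :=
    (QuotientAddGroup.eq_zero_iff _).2 (AddSubgroup.subset_closure ⟨m, a, n, rfl⟩)
  rw [map_sub] at h
  exact sub_eq_zero.1 h

/-- Additive maps out of `M ⊗_A N` are determined by their values on pure tensors. -/
theorem hom_ext {f g : Tensor A M N →+ P} (h : ∀ m n, f (tmul A m n) = g (tmul A m n)) :
    f = g := by
  refine QuotientAddGroup.addMonoidHom_ext _ ?_
  ext x
  induction x with
  | zero => simp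
  | tmul m n => exact h m n
  | add x y hx hy => rw [map_add, map_add, hx, hy]

/-- The universal property: an `A`-balanced biadditive map induces an additive map. -/
def lift (f : M →+ N →+ P) (hf : ∀ (m : M) (a : A) (n : N),
    f (MulOpposite.op a • m) n = f m (a • n)) : Tensor A M N →+ P :=
  QuotientAddGroup.lift (tensorRel A M N)
    (TensorProduct.liftAddHom (R := ℤ) f (fun r m n => by simp)) (by
      refine (AddSubgroup.closure_le _).2 ?_
      rintro _ ⟨m, a, n, rfl⟩
      simp [hf])

@[simp]
theorem lift_tmul (f : M →+ N →+ P) (hf : ∀ (m : M) (a : A) (n : N),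
    f (MulOpposite.op a • m) n = f m (a • n)) (m : M) (n : N) :
    lift f hf (tmul A m n) = f m n := rfl

/-- The biadditive map `(m, n) ↦ m ⊗ n`. -/
def mkHom (A M N : Type*) [Ring A] [AddCommGroup M] [AddCommGroup N]
    [Module Aᵐᵒᵖ M] [Module A N] : M →+ N →+ Tensor A M N :=
  AddMonoidHom.mk' (fun m => AddMonoidHom.mk' (fun n => tmul A m n) (tmul_add m))
    (fun m m' => by ext n; exact add_tmul m m' n)

@[simp]
theorem mkHom_apply (m : M) (n : N) : mkHom A M N m n = tmul A m n := rfl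

/-- The map `f ⊗_A g`. -/
def map (f : M →ₗ[Aᵐᵒᵖ] M') (g : N →ₗ[A] N') : Tensor A M N →+ Tensor A M' N' :=
  lift (((mkHom A M' N').compl₂ g.toAddMonoidHom).comp f.toAddMonoidHom)
    (fun m a n => by simp [smul_tmul])

@[simp]
theorem map_tmul (f : M →ₗ[Aᵐᵒᵖ] M') (g : N →ₗ[A] N') (m : M) (n : N) :
    map f g (tmul A m n) = tmul A (f m) (g n) := rfl

/-- Left multiplication by `a` on a bimodule, as a map of right modules. -/
def lmul [Module A M] [SMulCommClass A Aᵐᵒᵖ M] (a : A) : M →ₗ[Aᵐᵒᵖ] M where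
  toFun m := a • m
  map_add' := smul_add a
  map_smul' b m := smul_comm a b m

/-- Right multiplication by `b` on a bimodule, as a map of left modules. -/
def rmul [Module Aᵐᵒᵖ N] [SMulCommClass A Aᵐᵒᵖ N] (b : Aᵐᵒᵖ) : N →ₗ[A] N where
  toFun n := b • n
  map_add' := smul_add b
  map_smul' a n := (smul_comm a b n).symm

/-- The left `A`-module structure `a · (m ⊗ n) = (a · m) ⊗ n` on `M ⊗_A N`. -/
instance leftModule [Module A M] [SMulCommClass A Aᵐᵒᵖ M] : Module A (Tensor A M N) where
  smul a x := map (lmul a) LinearMap.id x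
  one_smul x := DFunLike.congr_fun (f := map (lmul (1 : A)) LinearMap.id) (g := AddMonoidHom.id _)
    (hom_ext fun m n => by simp [lmul]) x
  mul_smul a b x := DFunLike.congr_fun (f := map (lmul (a * b)) LinearMap.id)
    (g := (map (lmul a) LinearMap.id).comp (map (lmul b) LinearMap.id))
    (hom_ext fun m n => by simp [lmul, mul_smul]) x
  smul_zero a := map_zero _
  smul_add a := map_add _
  add_smul a b x := DFunLike.congr_fun (f := map (lmul (a + b)) LinearMap.id)
    (g := map (lmul a) LinearMap.id + map (lmul b) LinearMap.id)
    (hom_ext fun m n => by simp [lmul, add_smul, add_tmul]) x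
  zero_smul x := DFunLike.congr_fun (f := map (lmul (0 : A)) LinearMap.id) (g := 0)
    (hom_ext fun m n => by
      change tmul A ((0 : A) • m) n = 0
      rw [zero_smul]
      exact map_zero ((mkHom A M N).flip n)) x

/-- The right `A`-module structure `(m ⊗ n) · b = m ⊗ (n · b)` on `M ⊗_A N`. -/
instance rightModule [Module Aᵐᵒᵖ N] [SMulCommClass A Aᵐᵒᵖ N] :
    Module Aᵐᵒᵖ (Tensor A M N) where
  smul b x := map LinearMap.id (rmul b) x
  one_smul x := DFunLike.congr_fun (f := map LinearMap.id (rmul (1 : Aᵐᵒᵖ)))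
    (g := AddMonoidHom.id _) (hom_ext fun m n => by simp [rmul]) x
  mul_smul a b x := DFunLike.congr_fun (f := map LinearMap.id (rmul (a * b)))
    (g := (map LinearMap.id (rmul a)).comp (map LinearMap.id (rmul b)))
    (hom_ext fun m n => by simp [rmul, mul_smul]) x
  smul_zero a := map_zero _
  smul_add a := map_add _
  add_smul a b x := DFunLike.congr_fun (f := map LinearMap.id (rmul (a + b)))
    (g := map LinearMap.id (rmul a) + map LinearMap.id (rmul b))
    (hom_ext fun m n => by simp [rmul, add_smul, tmul_add]) x
  zero_smul x := DFunLike.congr_fun (f := map LinearMap.id (rmul (0 : Aᵐᵒᵖ))) (g := 0)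
    (hom_ext fun m n => by
      change tmul A m ((0 : Aᵐᵒᵖ) • n) = 0
      rw [zero_smul]
      exact map_zero (mkHom A M N m)) x

theorem smul_tmul_left [Module A M] [SMulCommClass A Aᵐᵒᵖ M] (a : A) (m : M) (n : N) :
    a • tmul A m n = tmul A (a • m) n := rfl

theorem smul_tmul_right [Module Aᵐᵒᵖ N] [SMulCommClass A Aᵐᵒᵖ N] (b : Aᵐᵒᵖ) (m : M) (n : N) :
    b • tmul A m n = tmul A m (b • n) := rfl

instance [Module A M] [SMulCommClass A Aᵐᵒᵖ M] [Module Aᵐᵒᵖ N] [SMulCommClass A Aᵐᵒᵖ N] :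
    SMulCommClass A Aᵐᵒᵖ (Tensor A M N) where
  smul_comm a b x := DFunLike.congr_fun
    (f := (map (lmul a) LinearMap.id).comp (map LinearMap.id (rmul b)))
    (g := (map LinearMap.id (rmul b)).comp (map (lmul a) LinearMap.id))
    (hom_ext fun m n => by simp) x

/-- The additive map `m ⊗ n ↦ (p ↦ m ⊗ (n ⊗ p))`. -/
def assocAux (A M N P : Type*) [Ring A] [AddCommGroup M] [AddCommGroup N] [AddCommGroup P]
    [Module Aᵐᵒᵖ M] [Module A N] [Module Aᵐᵒᵖ N] [SMulCommClass A Aᵐᵒᵖ N] [Module A P] :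
    Tensor A M N →+ P →+ Tensor A M (Tensor A N P) :=
  lift
    (AddMonoidHom.mk' (fun m => AddMonoidHom.mk'
        (fun n => ((mkHom A M (Tensor A N P)) m).comp (mkHom A N P n))
        (fun n n' => by ext p; simp [tmul_add]))
      (fun m m' => by ext n p; simp))
    (fun m a n => by ext p; simp [smul_tmul, smul_tmul_left])

/-- The canonical map `(M ⊗_A N) ⊗_A P → M ⊗_A (N ⊗_A P)`, `(m ⊗ n) ⊗ p ↦ m ⊗ (n ⊗ p)`. -/
def assoc (A M N P : Type*) [Ring A] [AddCommGroup M] [AddCommGroup N] [AddCommGroup P]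
    [Module Aᵐᵒᵖ M] [Module A N] [Module Aᵐᵒᵖ N] [SMulCommClass A Aᵐᵒᵖ N] [Module A P] :
    Tensor A (Tensor A M N) P →+ Tensor A M (Tensor A N P) :=
  lift (assocAux A M N P) (fun x a p => DFunLike.congr_fun
    (f := ((assocAux A M N P).flip p).comp (map LinearMap.id (rmul (MulOpposite.op a))))
    (g := (assocAux A M N P).flip (a • p))
    (hom_ext fun m n => by
      change tmul A m (tmul A (MulOpposite.op a • n) p) = tmul A m (tmul A n (a • p))
      rw [smul_tmul]) x)

@[simp]
theorem assoc_tmul {A M N P : Type*} [Ring A] [AddCommGroup M] [AddCommGroup N] [AddCommGroup P]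
    [Module Aᵐᵒᵖ M] [Module A N] [Module Aᵐᵒᵖ N] [SMulCommClass A Aᵐᵒᵖ N] [Module A P]
    (m : M) (n : N) (p : P) :
    assoc A M N P (tmul A (tmul A m n) p) = tmul A m (tmul A n p) := rfl

end Tensor

end Tensor

section Bimodule

/-- A homomorphism of `A`-bimodules. -/
structure BimoduleHom (A M N : Type*) [Ring A] [AddCommGroup M] [Module A M] [Module Aᵐᵒᵖ M]
    [AddCommGroup N] [Module A N] [Module Aᵐᵒᵖ N] extends M →ₗ[A] N where
  map_op_smul' : ∀ (b : Aᵐᵒᵖ) (x : M), toFun (b • x) = b • toFun x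

variable {A M N : Type*} [Ring A] [AddCommGroup M] [Module A M] [Module Aᵐᵒᵖ M]
    [AddCommGroup N] [Module A N] [Module Aᵐᵒᵖ N]

/-- The underlying map of left `A`-modules. -/
def BimoduleHom.left (f : BimoduleHom A M N) : M →ₗ[A] N := f.toLinearMap

/-- The underlying map of right `A`-modules. -/
def BimoduleHom.right (f : BimoduleHom A M N) : M →ₗ[Aᵐᵒᵖ] N where
  toFun := f.toFun
  map_add' := f.map_add'
  map_smul' := f.map_op_smul'

instance : CoeFun (BimoduleHom A M N) (fun _ => M → N) := ⟨fun f => f.toFun⟩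

/-- An `R`-`S`-bimodule `M` is of finite type if `M = ∑ᵢ R mᵢ S` for finitely many `mᵢ ∈ M`. -/
def IsFiniteType (R S M : Type*) [Ring R] [Ring S] [AddCommGroup M] [Module R M]
    [Module Sᵐᵒᵖ M] : Prop :=
  ∃ s : Finset M, AddSubgroup.closure
    {x : M | ∃ m ∈ s, ∃ (r : R) (b : S), x = r • MulOpposite.op b • m} = ⊤

/-- A sub-bimodule of an `A`-bimodule: a left submodule which is closed under the right action. -/
structure SubBimodule (A M : Type*) [Ring A] [AddCommGroup M] [Module A M] [Module Aᵐᵒᵖ M]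
    extends Submodule A M where
  op_smul_mem' : ∀ (b : Aᵐᵒᵖ) {x : M}, x ∈ carrier → b • x ∈ carrier

namespace SubBimodule

instance : SetLike (SubBimodule A M) M where
  coe D := D.carrier
  coe_injective D E h := by
    obtain ⟨D, hD⟩ := D
    obtain ⟨E, hE⟩ := E
    congr
    exact SetLike.coe_injective h

instance : AddSubgroupClass (SubBimodule A M) M where
  add_mem {D} _ _ := D.toSubmodule.add_mem
  zero_mem D := D.toSubmodule.zero_mem
  neg_mem {D} _ := D.toSubmodule.neg_mem

instance : SMulMemClass (SubBimodule A M) A M where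
  smul_mem {D} a _ h := D.toSubmodule.smul_mem a h

instance : SMulMemClass (SubBimodule A M) Aᵐᵒᵖ M where
  smul_mem {D} b _ h := D.op_smul_mem' b h

instance [SMulCommClass A Aᵐᵒᵖ M] (D : SubBimodule A M) : SMulCommClass A Aᵐᵒᵖ D where
  smul_comm a b x := Subtype.ext (smul_comm a b (x : M))

/-- The inclusion of a sub-bimodule. -/
def incl (D : SubBimodule A M) : BimoduleHom A D M where
  toFun x := x
  map_add' _ _ := rfl
  map_smul' _ _ := rfl
  map_op_smul' _ _ := rfl

end SubBimodule

end Bimodule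

section Coring

open Tensor

/-- The structure of an `A`-coring on an `A`-bimodule `C`. -/
structure Coring (A C : Type*) [Ring A] [AddCommGroup C] [Module A C] [Module Aᵐᵒᵖ C]
    [SMulCommClass A Aᵐᵒᵖ C] where
  /-- The comultiplication `Δ : C → C ⊗_A C`. -/
  comul : BimoduleHom A C (Tensor A C C)
  /-- The counit `ε : C → A`. -/
  counit : BimoduleHom A C A
  coassoc : ∀ c, assoc A C C C (map comul.right LinearMap.id (comul c)) =
    map LinearMap.id comul.left (comul c)
  id_counit_comul : ∀ c, map LinearMap.id counit.left (comul c) = tmul A c (1 : A)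
  counit_id_comul : ∀ c, map counit.right LinearMap.id (comul c) = tmul A (1 : A) c

variable {A C : Type*} [Ring A] [AddCommGroup C] [Module A C] [Module Aᵐᵒᵖ C]
  [SMulCommClass A Aᵐᵒᵖ C]

/-- The structure of a `C`-`C`-bicomodule on an `A`-bimodule `M`, for an `A`-coring `C`. -/
structure Bicomodule (S : Coring A C) (M : Type*) [AddCommGroup M] [Module A M]
    [Module Aᵐᵒᵖ M] [SMulCommClass A Aᵐᵒᵖ M] where
  /-- The right coaction `ρ : M → M ⊗_A C`. -/
  rho : BimoduleHom A M (Tensor A M C)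
  /-- The left coaction `λ : M → C ⊗_A M`. -/
  lam : BimoduleHom A M (Tensor A C M)
  rho_coassoc : ∀ m, assoc A M C C (map rho.right LinearMap.id (rho m)) =
    map LinearMap.id S.comul.left (rho m)
  rho_counit : ∀ m, map LinearMap.id S.counit.left (rho m) = tmul A m (1 : A)
  lam_coassoc : ∀ m, assoc A C C M (map S.comul.right LinearMap.id (lam m)) =
    map LinearMap.id lam.left (lam m)
  lam_counit : ∀ m, map S.counit.right LinearMap.id (lam m) = tmul A (1 : A) m
  compat : ∀ m, assoc A C M C (map lam.right LinearMap.id (rho m)) =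
    map LinearMap.id rho.left (lam m)

/-- A coring is a bicomodule over itself through its comultiplication. -/
def Coring.regular (S : Coring A C) : Bicomodule S C where
  rho := S.comul
  lam := S.comul
  rho_coassoc := S.coassoc
  rho_counit := S.id_counit_comul
  lam_coassoc := S.coassoc
  lam_counit := S.counit_id_comul
  compat := S.coassoc

/-- A bimodule map is a morphism of bicomodules if it commutes with both coactions. -/
def IsBicomoduleHom {S : Coring A C} {M N : Type*} [AddCommGroup M] [Module A M]
    [Module Aᵐᵒᵖ M] [SMulCommClass A Aᵐᵒᵖ M] [AddCommGroup N] [Module A N]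
    [Module Aᵐᵒᵖ N] [SMulCommClass A Aᵐᵒᵖ N] (X : Bicomodule S M) (Y : Bicomodule S N)
    (f : BimoduleHom A M N) : Prop :=
  (∀ m, Y.rho (f m) = map f.right LinearMap.id (X.rho m)) ∧
    (∀ m, Y.lam (f m) = map LinearMap.id f.left (X.lam m))

/-- A sub-bimodule `D` of the coring `C` is a subbicomodule if it carries a bicomodule structure
for which the inclusion into `C` is a morphism of bicomodules. -/
def Coring.IsSubbicomodule (S : Coring A C) (D : SubBimodule A C) : Prop :=
  ∃ X : Bicomodule S D, IsBicomoduleHom X S.regular D.incl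

/-- A coring is simple if it has no nontrivial subbicomodules. -/
def Coring.IsSimple (S : Coring A C) : Prop :=
  ∀ D : SubBimodule A C, S.IsSubbicomodule D → (D : Set C) = {0} ∨ (D : Set C) = Set.univ

end Coring

end CoringTheory

/-! Write `R_g(c) = ∑ c₁ · g(c₂)` for a left linear functional `g` on `C`, and `L_f(c) = ∑ f(c₁) ·
c₂` for a right linear functional `f`. These are `convRight` and `convLeft`. Given `c`, let `D` be
the additive span of all `L_f (R_g c)`, the elements `∑ f(c₁) · c₂ · g(c₃)`. Taking `f = g = ε`
shows `c ∈ D`. By coassociativity `R_g` and `L_f` commute, and the `R_g` (likewise the `L_f`) are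
closed under composition, so `D` is stable under all of them.

Projectivity enters through dual bases, in two ways. First, expanding `Δ(c)` along a dual basis
writes every `R_g(c)` as a combination of one finite family that does not depend on `g`. The same on
the left makes `D` of finite type (`isFiniteType_generated`). Second, a stable `D` is a
subbicomodule (`isSubbicomodule_of_conv_mem`): `Δ(D)` lies in the images of `D ⊗ C` and `C ⊗ D`,
which embed in `C ⊗ C` by flatness, so `Δ` restricts to coactions. Their axioms can be checked in `C
⊗ C ⊗ C`, or in `C ⊗ A` and `A ⊗ C` for the counits.

The subbicomodules `D` cover `C`. If `C` is simple and nonzero, any `c ≠ 0` gives `D = C`. -/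

namespace CoringTheory

namespace Tensor

variable {A M N P Q M' N' P' : Type*} [Ring A]
  [AddCommGroup M] [AddCommGroup N] [AddCommGroup P] [AddCommGroup Q]
  [AddCommGroup M'] [AddCommGroup N'] [AddCommGroup P']

/-! ### Contractions of tensors along one-sided functionals -/

section Contraction

variable [Module Aᵐᵒᵖ M] [Module A N] [Module Aᵐᵒᵖ M'] [Module A N']

/-- Induction on elements of `M ⊗_A N`. -/
theorem induction {p : Tensor A M N → Prop} (t : Tensor A M N)
    (tmul : ∀ m n, p (tmul A m n)) (zero : p 0) (add : ∀ x y, p x → p y → p (x + y)) : p t := by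
  obtain ⟨t, rfl⟩ := QuotientAddGroup.mk'_surjective (tensorRel A M N) t
  induction t with
  | zero => rw [map_zero]; exact zero
  | tmul m n => exact tmul m n
  | add x y hx hy => rw [map_add]; exact add _ _ hx hy

theorem zero_tmul (n : N) : tmul A (0 : M) n = 0 := map_zero ((mkHom A M N).flip n)

theorem tmul_zero (m : M) : tmul A m (0 : N) = 0 := map_zero (mkHom A M N m)

theorem tmul_sum {ι : Type*} (m : M) (s : Finset ι) (f : ι → N) :
    tmul A m (∑ i ∈ s, f i) = ∑ i ∈ s, tmul A m (f i) := map_sum (mkHom A M N m) f s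

theorem sum_tmul {ι : Type*} (s : Finset ι) (f : ι → M) (n : N) :
    tmul A (∑ i ∈ s, f i) n = ∑ i ∈ s, tmul A (f i) n := map_sum ((mkHom A M N).flip n) f s

theorem map_id_id (t : Tensor A M N) : map LinearMap.id LinearMap.id t = t :=
  DFunLike.congr_fun (f := map LinearMap.id LinearMap.id) (g := AddMonoidHom.id _)
    (hom_ext fun _ _ => rfl) t

theorem map_map [Module Aᵐᵒᵖ P] [Module A Q] (f' : M' →ₗ[Aᵐᵒᵖ] P) (g' : N' →ₗ[A] Q)
    (f : M →ₗ[Aᵐᵒᵖ] M') (g : N →ₗ[A] N') (t : Tensor A M N) :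
    map f' g' (map f g t) = map (f'.comp f) (g'.comp g) t :=
  DFunLike.congr_fun (f := (map f' g').comp (map f g))
    (g := map (f'.comp f) (g'.comp g)) (hom_ext fun _ _ => rfl) t

/-- The contraction `m ⊗ n ↦ m · g(n)` along a left linear functional `g`. -/
def contractRight (M : Type*) [AddCommGroup M] [Module Aᵐᵒᵖ M] (g : N →ₗ[A] A) :
    Tensor A M N →+ M :=
  lift (AddMonoidHom.mk' (fun m => AddMonoidHom.mk' (fun n => MulOpposite.op (g n) • m)
      (fun n n' => by rw [map_add, MulOpposite.op_add, add_smul]))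
    (fun m m' => by ext n; exact smul_add _ _ _))
    (fun m a n => by
      change MulOpposite.op (g n) • MulOpposite.op a • m = MulOpposite.op (g (a • n)) • m
      rw [map_smul, smul_smul, smul_eq_mul, MulOpposite.op_mul])

/-- The contraction `m ⊗ n ↦ f(m) · n` along a right linear functional `f`. -/
def contractLeft (N : Type*) [AddCommGroup N] [Module A N] (f : M →ₗ[Aᵐᵒᵖ] A) :
    Tensor A M N →+ N :=
  lift (AddMonoidHom.mk' (fun m => AddMonoidHom.mk' (fun n => f m • n) (smul_add (f m)))
    (fun m m' => by
      ext n
      change f (m + m') • n = f m • n + f m' • n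
      rw [map_add, add_smul]))
    (fun m a n => by
      change f (MulOpposite.op a • m) • n = f m • a • n
      rw [map_smul, smul_smul, op_smul_eq_mul])

@[simp]
theorem contractRight_tmul (g : N →ₗ[A] A) (m : M) (n : N) :
    contractRight M g (tmul A m n) = MulOpposite.op (g n) • m := rfl

@[simp]
theorem contractLeft_tmul (f : M →ₗ[Aᵐᵒᵖ] A) (m : M) (n : N) :
    contractLeft N f (tmul A m n) = f m • n := rfl

theorem contractRight_map (g : N' →ₗ[A] A) (h : M →ₗ[Aᵐᵒᵖ] M') (k : N →ₗ[A] N')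
    (t : Tensor A M N) :
    contractRight M' g (map h k t) = h (contractRight M (g.comp k) t) :=
  DFunLike.congr_fun (f := (contractRight M' g).comp (map h k))
    (g := h.toAddMonoidHom.comp (contractRight M (g.comp k)))
    (hom_ext fun m n => (h.map_smul (MulOpposite.op (g (k n))) m).symm) t

theorem contractLeft_map (f : M' →ₗ[Aᵐᵒᵖ] A) (h : M →ₗ[Aᵐᵒᵖ] M') (k : N →ₗ[A] N')
    (t : Tensor A M N) :
    contractLeft N' f (map h k t) = k (contractLeft N (f.comp h) t) :=
  DFunLike.congr_fun (f := (contractLeft N' f).comp (map h k))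
    (g := k.toAddMonoidHom.comp (contractLeft N (f.comp h)))
    (hom_ext fun m n => (k.map_smul (f (h m)) n).symm) t

end Contraction

/-! ### Dual bases and flatness -/

section DualBasis

variable {ι : Type*}

/-- A dual basis of a left `A`-module: `p = ∑ⱼ sⱼ(p) · eⱼ` with a locally finite sum. -/
def IsLeftDualBasis [Module A P] (e : ι → P) (s : ι → P →ₗ[A] A) : Prop :=
  ∀ p, ∃ F : Finset ι, ∀ F', F ⊆ F' → ∑ j ∈ F', s j p • e j = p

/-- A dual basis of a right `A`-module: `m = ∑ⱼ eⱼ · sⱼ(m)` with a locally finite sum. -/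
def IsRightDualBasis [Module Aᵐᵒᵖ M] (e : ι → M) (s : ι → M →ₗ[Aᵐᵒᵖ] A) : Prop :=
  ∀ m, ∃ F : Finset ι, ∀ F', F ⊆ F' → ∑ j ∈ F', MulOpposite.op (s j m) • e j = m

theorem exists_isLeftDualBasis [Module A P] (h : Module.Projective A P) :
    ∃ s : P → P →ₗ[A] A, IsLeftDualBasis id s := by
  obtain ⟨σ, hσ⟩ := h.out
  refine ⟨fun j => (Finsupp.lapply j).comp σ, fun p => ⟨(σ p).support, fun F' hF' => ?_⟩⟩
  conv_rhs => rw [← hσ p, Finsupp.linearCombination_apply]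
  exact (Finsupp.sum_of_support_subset _ hF' (fun j (a : A) => a • id j)
    (fun j _ => zero_smul _ (id j))).symm

theorem exists_isRightDualBasis [Module Aᵐᵒᵖ M] (h : Module.Projective Aᵐᵒᵖ M) :
    ∃ s : M → M →ₗ[Aᵐᵒᵖ] A, IsRightDualBasis id s := by
  obtain ⟨σ, hσ⟩ := h.out
  -- Projectivity over `Aᵐᵒᵖ` yields coefficients in `Aᵐᵒᵖ`; `u` reads them as elements of the right
  -- module `A`.
  let u : Aᵐᵒᵖ →ₗ[Aᵐᵒᵖ] A :=
    { toFun := MulOpposite.unop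
      map_add' := fun _ _ => rfl
      map_smul' := fun _ _ => rfl }
  refine ⟨fun j => u.comp ((Finsupp.lapply j).comp σ),
    fun p => ⟨(σ p).support, fun F' hF' => ?_⟩⟩
  conv_rhs => rw [← hσ p, Finsupp.linearCombination_apply]
  exact (Finsupp.sum_of_support_subset _ hF' (fun j (a : Aᵐᵒᵖ) => a • id j)
    (fun j _ => zero_smul _ (id j))).symm

/-- Serves the counit axioms: an injection of right modules stays injective after `⊗ A`. -/
theorem isLeftDualBasis_self :
    IsLeftDualBasis (fun _ : Unit => (1 : A)) (fun _ => LinearMap.id) :=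
  fun p => ⟨Finset.univ, fun F' hF' => by
    rw [Finset.univ_subset_iff.1 hF']; simp⟩

theorem isRightDualBasis_self :
    IsRightDualBasis (fun _ : Unit => (1 : A)) (fun _ => (LinearMap.id : A →ₗ[Aᵐᵒᵖ] A)) :=
  fun p => ⟨Finset.univ, fun F' hF' => by
    rw [Finset.univ_subset_iff.1 hF']; simp⟩

/-- A locally finite decomposition of `N` by endomorphisms induces one of `M ⊗_A N`. -/
theorem exists_sum_map_right [Module Aᵐᵒᵖ M] [Module A N] {E : ι → N →ₗ[A] N}
    (hE : ∀ n, ∃ F : Finset ι, ∀ F', F ⊆ F' → ∑ j ∈ F', E j n = n) (t : Tensor A M N) :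
    ∃ F : Finset ι, ∀ F', F ⊆ F' → ∑ j ∈ F', map LinearMap.id (E j) t = t := by
  classical
  induction t using induction with
  | tmul m n =>
    obtain ⟨F, hF⟩ := hE n
    refine ⟨F, fun F' h => ?_⟩
    conv_rhs => rw [← hF F' h, tmul_sum]
    rfl
  | zero => exact ⟨∅, fun F' _ => by simp⟩
  | add x y hx hy =>
    obtain ⟨F, hF⟩ := hx
    obtain ⟨G, hG⟩ := hy
    -- Merging the two index sets works because each expansion holds for every larger finite set.
    refine ⟨F ∪ G, fun F' h => ?_⟩
    simp only [map_add, Finset.sum_add_distrib]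
    rw [hF F' (Finset.union_subset_left h), hG F' (Finset.union_subset_right h)]

/-- A locally finite decomposition of `M` by endomorphisms induces one of `M ⊗_A N`. -/
theorem exists_sum_map_left [Module Aᵐᵒᵖ M] [Module A N] {E : ι → M →ₗ[Aᵐᵒᵖ] M}
    (hE : ∀ m, ∃ F : Finset ι, ∀ F', F ⊆ F' → ∑ j ∈ F', E j m = m) (t : Tensor A M N) :
    ∃ F : Finset ι, ∀ F', F ⊆ F' → ∑ j ∈ F', map (E j) LinearMap.id t = t := by
  classical
  induction t using induction with
  | tmul m n =>
    obtain ⟨F, hF⟩ := hE m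
    refine ⟨F, fun F' h => ?_⟩
    conv_rhs => rw [← hF F' h, sum_tmul]
    rfl
  | zero => exact ⟨∅, fun F' _ => by simp⟩
  | add x y hx hy =>
    obtain ⟨F, hF⟩ := hx
    obtain ⟨G, hG⟩ := hy
    refine ⟨F ∪ G, fun F' h => ?_⟩
    simp only [map_add, Finset.sum_add_distrib]
    rw [hF F' (Finset.union_subset_left h), hG F' (Finset.union_subset_right h)]

/-- Substitute `p = ∑ sⱼ(p) · eⱼ` in the second factor and move the scalars across. An element of `M
⊗ P` is thus determined by its contractions along the `sⱼ`. -/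
theorem IsLeftDualBasis.exists_sum_tmul [Module Aᵐᵒᵖ M] [Module A P] {e : ι → P}
    {s : ι → P →ₗ[A] A} (h : IsLeftDualBasis e s) (t : Tensor A M P) :
    ∃ F : Finset ι, ∀ F', F ⊆ F' → ∑ j ∈ F', tmul A (contractRight M (s j) t) (e j) = t := by
  obtain ⟨F, hF⟩ := exists_sum_map_right (E := fun j => (s j).smulRight (e j)) h t
  refine ⟨F, fun F' h' => ?_⟩
  conv_rhs => rw [← hF F' h']
  refine Finset.sum_congr rfl fun j _ => ?_
  exact DFunLike.congr_fun (f := ((mkHom A M P).flip (e j)).comp (contractRight M (s j)))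
    (g := map LinearMap.id ((s j).smulRight (e j)))
    (hom_ext fun m p => smul_tmul m (s j p) (e j)) t

theorem IsRightDualBasis.exists_sum_tmul [Module Aᵐᵒᵖ M] [Module A P] {e : ι → M}
    {s : ι → M →ₗ[Aᵐᵒᵖ] A} (h : IsRightDualBasis e s) (t : Tensor A M P) :
    ∃ F : Finset ι, ∀ F', F ⊆ F' → ∑ j ∈ F', tmul A (e j) (contractLeft P (s j) t) = t := by
  let E : ι → M →ₗ[Aᵐᵒᵖ] M := fun j =>
    { toFun := fun m => MulOpposite.op (s j m) • e j
      map_add' := fun x y => by rw [map_add, MulOpposite.op_add, add_smul]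
      map_smul' := fun b x => by
        rw [map_smul, RingHom.id_apply, smul_smul]
        rfl }
  obtain ⟨F, hF⟩ := exists_sum_map_left (E := E) h t
  refine ⟨F, fun F' h' => ?_⟩
  conv_rhs => rw [← hF F' h']
  refine Finset.sum_congr rfl fun j _ => ?_
  exact DFunLike.congr_fun (f := (mkHom A M P (e j)).comp (contractLeft P (s j)))
    (g := map (E j) LinearMap.id)
    (hom_ext fun m p => (smul_tmul (e j) (s j m) p).symm) t

/-- Contraction commutes with `f`, so `f` kills every coordinate of a tensor in the kernel; these
coordinates then vanish, and so does the tensor. -/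
theorem IsLeftDualBasis.map_injective [Module Aᵐᵒᵖ M] [Module Aᵐᵒᵖ M'] [Module A P]
    {e : ι → P} {s : ι → P →ₗ[A] A} (h : IsLeftDualBasis e s) {f : M →ₗ[Aᵐᵒᵖ] M'}
    (hf : Function.Injective f) :
    Function.Injective (map f (LinearMap.id : P →ₗ[A] P)) := by
  refine (injective_iff_map_eq_zero _).2 fun t ht => ?_
  obtain ⟨F, hF⟩ := h.exists_sum_tmul t
  rw [← hF F subset_rfl]
  refine Finset.sum_eq_zero fun j _ => ?_
  have h0 := contractRight_map (s j) f LinearMap.id t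
  rw [ht, map_zero] at h0
  have h1 : contractRight M (s j) t = 0 := hf (h0.symm.trans (map_zero f).symm)
  rw [h1, zero_tmul]

theorem IsRightDualBasis.map_injective [Module Aᵐᵒᵖ M] [Module A P] [Module A P']
    {e : ι → M} {s : ι → M →ₗ[Aᵐᵒᵖ] A} (h : IsRightDualBasis e s) {f : P →ₗ[A] P'}
    (hf : Function.Injective f) :
    Function.Injective (map (LinearMap.id : M →ₗ[Aᵐᵒᵖ] M) f) := by
  refine (injective_iff_map_eq_zero _).2 fun t ht => ?_
  obtain ⟨F, hF⟩ := h.exists_sum_tmul t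
  rw [← hF F subset_rfl]
  refine Finset.sum_eq_zero fun j _ => ?_
  have h0 := contractLeft_map (s j) LinearMap.id f t
  rw [ht, map_zero] at h0
  have h1 : contractLeft P (s j) t = 0 := hf (h0.symm.trans (map_zero f).symm)
  rw [h1, tmul_zero]

/-- Lift the coordinates along `sⱼ` one by one and reassemble. This turns stability under the `R_g`
into a coaction. -/
theorem IsLeftDualBasis.mem_range_map [Module Aᵐᵒᵖ M] [Module Aᵐᵒᵖ M'] [Module A P]
    {e : ι → P} {s : ι → P →ₗ[A] A} (h : IsLeftDualBasis e s) {f : M →ₗ[Aᵐᵒᵖ] M'}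
    {t : Tensor A M' P} (ht : ∀ j, ∃ m, f m = contractRight M' (s j) t) :
    ∃ u : Tensor A M P, map f LinearMap.id u = t := by
  choose m hm using ht
  obtain ⟨F, hF⟩ := h.exists_sum_tmul t
  refine ⟨∑ j ∈ F, tmul A (m j) (e j), ?_⟩
  rw [map_sum]
  conv_rhs => rw [← hF F subset_rfl]
  exact Finset.sum_congr rfl fun j _ => by rw [← hm j]; rfl

theorem IsRightDualBasis.mem_range_map [Module Aᵐᵒᵖ M] [Module A P] [Module A P']
    {e : ι → M} {s : ι → M →ₗ[Aᵐᵒᵖ] A} (h : IsRightDualBasis e s) {f : P →ₗ[A] P'}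
    {t : Tensor A M P'} (ht : ∀ j, ∃ p, f p = contractLeft P' (s j) t) :
    ∃ u : Tensor A M P, map LinearMap.id f u = t := by
  choose p hp using ht
  obtain ⟨F, hF⟩ := h.exists_sum_tmul t
  refine ⟨∑ j ∈ F, tmul A (e j) (p j), ?_⟩
  rw [map_sum]
  conv_rhs => rw [← hF F subset_rfl]
  exact Finset.sum_congr rfl fun j _ => by rw [← hp j]; rfl

end DualBasis

/-! ### Tensor products of bimodule maps -/

section Bimodules

/-- The contraction `m ⊗ n ↦ m · g(n)` as a map of left modules. -/
def contractRightLinear (M : Type*) [AddCommGroup M] [Module A M] [Module Aᵐᵒᵖ M]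
    [SMulCommClass A Aᵐᵒᵖ M] [Module A N] (g : N →ₗ[A] A) : Tensor A M N →ₗ[A] M where
  toFun := contractRight M g
  map_add' := map_add _
  map_smul' a t := contractRight_map g (lmul a) LinearMap.id t

/-- The contraction `m ⊗ n ↦ f(m) · n` as a map of right modules. -/
def contractLeftLinear (N : Type*) [AddCommGroup N] [Module A N] [Module Aᵐᵒᵖ N]
    [SMulCommClass A Aᵐᵒᵖ N] [Module Aᵐᵒᵖ M] (f : M →ₗ[Aᵐᵒᵖ] A) :
    Tensor A M N →ₗ[Aᵐᵒᵖ] N where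
  toFun := contractLeft N f
  map_add' := map_add _
  map_smul' b t := contractLeft_map f LinearMap.id (rmul b) t

/-- The map `f ⊗_A g` as a map of left modules. -/
def mapLeft [Module A M] [Module Aᵐᵒᵖ M] [SMulCommClass A Aᵐᵒᵖ M] [Module A M']
    [Module Aᵐᵒᵖ M'] [SMulCommClass A Aᵐᵒᵖ M'] [Module A N] [Module A N']
    (f : BimoduleHom A M M') (g : N →ₗ[A] N') : Tensor A M N →ₗ[A] Tensor A M' N' where
  toFun := map f.right g
  map_add' := map_add _
  map_smul' a t := by
    refine DFunLike.congr_fun (f := (map f.right g).comp (map (lmul a) LinearMap.id))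
      (g := (map (lmul a) LinearMap.id).comp (map f.right g)) (hom_ext fun m n => ?_) t
    exact congrArg (fun x => tmul A x (g n)) (f.map_smul' a m)

/-- The map `f ⊗_A g` as a map of right modules. -/
def mapRight [Module Aᵐᵒᵖ M] [Module Aᵐᵒᵖ M'] [Module A N] [Module Aᵐᵒᵖ N]
    [SMulCommClass A Aᵐᵒᵖ N] [Module A N'] [Module Aᵐᵒᵖ N'] [SMulCommClass A Aᵐᵒᵖ N']
    (f : M →ₗ[Aᵐᵒᵖ] M') (g : BimoduleHom A N N') :
    Tensor A M N →ₗ[Aᵐᵒᵖ] Tensor A M' N' where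
  toFun := map f g.left
  map_add' := map_add _
  map_smul' b t := by
    refine DFunLike.congr_fun (f := (map f g.left).comp (map LinearMap.id (rmul b)))
      (g := (map LinearMap.id (rmul b)).comp (map f g.left)) (hom_ext fun m n => ?_) t
    exact congrArg (fun x => tmul A (f m) x) (g.map_op_smul' b n)

theorem assoc_map [Module Aᵐᵒᵖ M] [Module Aᵐᵒᵖ M'] [Module A N] [Module Aᵐᵒᵖ N]
    [SMulCommClass A Aᵐᵒᵖ N] [Module A N'] [Module Aᵐᵒᵖ N'] [SMulCommClass A Aᵐᵒᵖ N']
    [Module A P] [Module A P'] (f : M →ₗ[Aᵐᵒᵖ] M') (g : BimoduleHom A N N') (h : P →ₗ[A] P')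
    (t : Tensor A (Tensor A M N) P) :
    assoc A M' N' P' (map (mapRight f g) h t) =
      map f (mapLeft g h) (assoc A M N P t) := by
  induction t using induction with
  | zero => simp only [map_zero]
  | add x y hx hy => simp only [map_add, hx, hy]
  | tmul x p =>
    induction x using induction with
    | zero => simp only [zero_tmul, map_zero]
    | add x y hx hy => simp only [add_tmul, map_add, hx, hy]
    | tmul m n => rfl

/-- Right flatness of `N ⊗_A P` for `P` with a dual basis: injections of right modules stay
injective if they do so after tensoring with `N`. -/
theorem IsLeftDualBasis.map_tensor_injective {ι : Type*} [Module Aᵐᵒᵖ M] [Module Aᵐᵒᵖ M']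
    [Module A N] [Module Aᵐᵒᵖ N] [SMulCommClass A Aᵐᵒᵖ N] [Module A P] {e : ι → P}
    {s : ι → P →ₗ[A] A} (h : IsLeftDualBasis e s) {f : M →ₗ[Aᵐᵒᵖ] M'}
    (hf : Function.Injective (map f (LinearMap.id : N →ₗ[A] N))) :
    Function.Injective (map f (LinearMap.id : Tensor A N P →ₗ[A] Tensor A N P)) := by
  refine (injective_iff_map_eq_zero _).2 fun t ht => ?_
  let r : ι → N →ₗ[A] Tensor A N P := fun j =>
    { toFun := fun n => tmul A n (e j)
      map_add' := fun x y => add_tmul x y (e j)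
      map_smul' := fun _ _ => rfl }
  -- The dual basis splits the identity of `N ⊗ P` into endomorphisms that factor through `N`, so
  -- the hypothesis on `N` applies to each summand. No dual basis of `N ⊗ P` is needed.
  obtain ⟨F, hF⟩ := exists_sum_map_right
    (E := fun j => (r j).comp (contractRightLinear N (s j))) (fun u => h.exists_sum_tmul u) t
  rw [← hF F subset_rfl]
  refine Finset.sum_eq_zero fun j _ => ?_
  have h0 : map LinearMap.id (contractRightLinear N (s j)) t = 0 := by
    refine hf ?_
    rw [map_zero, map_map]
    have := congrArg (map LinearMap.id (contractRightLinear N (s j))) ht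
    rw [map_map, map_zero] at this
    exact this
  have h1 := map_map LinearMap.id (r j) LinearMap.id (contractRightLinear N (s j)) t
  rw [h0, map_zero] at h1
  exact h1.symm

end Bimodules

end Tensor

end CoringTheory

namespace CoringTheory

open Tensor

/-! ### Convolution operators on a coring -/

section Convolution

variable {A C : Type*} [Ring A] [AddCommGroup C] [Module A C] [Module Aᵐᵒᵖ C]
  [SMulCommClass A Aᵐᵒᵖ C]

namespace Tensor

variable {M N P : Type*} [AddCommGroup M] [AddCommGroup N] [AddCommGroup P]
  [Module Aᵐᵒᵖ M] [Module A N] [Module Aᵐᵒᵖ N] [SMulCommClass A Aᵐᵒᵖ N] [Module A P]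

theorem contractRight_assoc (h : N →ₗ[A] A) (g : P →ₗ[A] A) (u : Tensor A (Tensor A M N) P) :
    contractRight M (h.comp (contractRightLinear N g)) (assoc A M N P u) =
      contractRight M h (contractRight (Tensor A M N) g u) := by
  induction u using induction with
  | zero => simp only [map_zero]
  | add x y hx hy => simp only [map_add, hx, hy]
  | tmul x p =>
    induction x using induction with
    | zero => simp only [zero_tmul, map_zero]
    | add x y hx hy => simp only [add_tmul, map_add, hx, hy]
    | tmul m n => rfl

theorem contractLeft_assoc (h : N →ₗ[Aᵐᵒᵖ] A) (f : M →ₗ[Aᵐᵒᵖ] A)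
    (u : Tensor A (Tensor A M N) P) :
    contractLeft P h (contractLeft (Tensor A N P) f (assoc A M N P u)) =
      contractLeft P (h.comp (contractLeftLinear N f)) u := by
  induction u using induction with
  | zero => simp only [map_zero]
  | add x y hx hy => simp only [map_add, hx, hy]
  | tmul x p =>
    induction x using induction with
    | zero => simp only [zero_tmul, map_zero]
    | add x y hx hy => simp only [add_tmul, map_add, hx, hy]
    | tmul m n => rfl

theorem contractRight_contractLeft_assoc (f : M →ₗ[Aᵐᵒᵖ] A) (g : P →ₗ[A] A)
    (u : Tensor A (Tensor A M N) P) :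
    contractRight N g (contractLeft (Tensor A N P) f (assoc A M N P u)) =
      contractLeft N f (contractRight (Tensor A M N) g u) := by
  induction u using induction with
  | zero => simp only [map_zero]
  | add x y hx hy => simp only [map_add, hx, hy]
  | tmul x p =>
    induction x using induction with
    | zero => simp only [zero_tmul, map_zero]
    | add x y hx hy => simp only [add_tmul, map_add, hx, hy]
    | tmul m n => exact (smul_comm (f m) (MulOpposite.op (g p)) n).symm

end Tensor

namespace Coring

variable (S : Coring A C)

/-- The operator `c ↦ ∑ c₁ · g(c₂)` of a left linear functional `g`. -/
def convRight (g : C →ₗ[A] A) : C →ₗ[A] C := (contractRightLinear C g).comp S.comul.left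

/-- The operator `c ↦ ∑ f(c₁) · c₂` of a right linear functional `f`. -/
def convLeft (f : C →ₗ[Aᵐᵒᵖ] A) : C →ₗ[Aᵐᵒᵖ] C :=
  (contractLeftLinear C f).comp S.comul.right

theorem comul_convRight (g : C →ₗ[A] A) (c : C) :
    S.comul (S.convRight g c) =
      contractRight (Tensor A C C) g (map S.comul.right LinearMap.id (S.comul c)) :=
  (contractRight_map g S.comul.right LinearMap.id (S.comul c)).symm

theorem comul_convLeft (f : C →ₗ[Aᵐᵒᵖ] A) (c : C) :
    S.comul (S.convLeft f c) =
      contractLeft (Tensor A C C) f (map LinearMap.id S.comul.left (S.comul c)) :=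
  (contractLeft_map f LinearMap.id S.comul.left (S.comul c)).symm

/-- By coassociativity both sides are `∑ c₁ · h(c₂ · g(c₃))`. -/
theorem convRight_convRight (h g : C →ₗ[A] A) (c : C) :
    S.convRight h (S.convRight g c) = S.convRight (h.comp (S.convRight g)) c := by
  change contractRight C h (S.comul (S.convRight g c)) = _
  rw [comul_convRight, ← contractRight_assoc, S.coassoc, contractRight_map]
  rfl

theorem convLeft_convLeft (h f : C →ₗ[Aᵐᵒᵖ] A) (c : C) :
    S.convLeft h (S.convLeft f c) = S.convLeft (h.comp (S.convLeft f)) c := by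
  change contractLeft C h (S.comul (S.convLeft f c)) = _
  rw [comul_convLeft, ← S.coassoc, contractLeft_assoc, contractLeft_map]
  rfl

/-- By coassociativity both sides are `∑ f(c₁) · c₂ · g(c₃)`. -/
theorem convRight_convLeft (f : C →ₗ[Aᵐᵒᵖ] A) (g : C →ₗ[A] A) (c : C) :
    S.convRight g (S.convLeft f c) = S.convLeft f (S.convRight g c) := by
  change contractRight C g (S.comul (S.convLeft f c)) =
    contractLeft C f (S.comul (S.convRight g c))
  rw [comul_convLeft, comul_convRight, ← S.coassoc, contractRight_contractLeft_assoc]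

theorem convRight_counit (c : C) : S.convRight S.counit.left c = c := by
  have h := congrArg (contractRight C LinearMap.id) (S.id_counit_comul c)
  rw [contractRight_map, contractRight_tmul] at h
  exact h.trans (one_smul Aᵐᵒᵖ c)

theorem convLeft_counit (c : C) : S.convLeft S.counit.right c = c := by
  have h := congrArg (contractLeft C LinearMap.id) (S.counit_id_comul c)
  rw [contractLeft_map, contractLeft_tmul] at h
  exact h.trans (one_smul A c)

theorem op_smul_convRight (b : Aᵐᵒᵖ) (g : C →ₗ[A] A) (c : C) :
    b • S.convRight g c = S.convRight ((rmul b).comp g) c := by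
  change b • contractRight C g (S.comul c) = contractRight C ((rmul b).comp g) (S.comul c)
  induction S.comul c using Tensor.induction with
  | zero => simp only [map_zero, smul_zero]
  | add x y hx hy => simp only [map_add, smul_add, hx, hy]
  | tmul m n => exact smul_smul b (MulOpposite.op (g n)) m

theorem smul_convLeft (a : A) (f : C →ₗ[Aᵐᵒᵖ] A) (c : C) :
    a • S.convLeft f c = S.convLeft ((lmul a).comp f) c := by
  change a • contractLeft C f (S.comul c) = contractLeft C ((lmul a).comp f) (S.comul c)
  induction S.comul c using Tensor.induction with
  | zero => simp only [map_zero, smul_zero]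
  | add x y hx hy => simp only [map_add, smul_add, hx, hy]
  | tmul m n => exact smul_smul a (f m) n

/-- The source of finiteness: `F` comes from expanding `Δ(c)` along the dual basis, before `g` is
chosen. -/
theorem exists_convRight_eq_sum {ι : Type*} {e : ι → C} {s : ι → C →ₗ[A] A}
    (h : IsLeftDualBasis e s) (c : C) :
    ∃ F : Finset ι, ∀ g : C →ₗ[A] A,
      S.convRight g c = ∑ j ∈ F, MulOpposite.op (g (e j)) • S.convRight (s j) c := by
  obtain ⟨F, hF⟩ := h.exists_sum_tmul (S.comul c)
  refine ⟨F, fun g => ?_⟩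
  have := congrArg (contractRight C g) (hF F subset_rfl)
  rw [map_sum] at this
  exact this.symm

theorem exists_convLeft_eq_sum {ι : Type*} {e : ι → C} {s : ι → C →ₗ[Aᵐᵒᵖ] A}
    (h : IsRightDualBasis e s) (c : C) :
    ∃ F : Finset ι, ∀ f : C →ₗ[Aᵐᵒᵖ] A,
      S.convLeft f c = ∑ j ∈ F, f (e j) • S.convLeft (s j) c := by
  obtain ⟨F, hF⟩ := h.exists_sum_tmul (S.comul c)
  refine ⟨F, fun g => ?_⟩
  have := congrArg (contractLeft C g) (hF F subset_rfl)
  rw [map_sum] at this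
  exact this.symm

/-! ### The subbicomodule generated by one element -/

/-- The sub-bimodule of all sums of elements `∑ f(c₁) · c₂ · g(c₃)`. -/
def generated (c : C) : SubBimodule A C where
  carrier := AddSubgroup.closure
    {x | ∃ (f : C →ₗ[Aᵐᵒᵖ] A) (g : C →ₗ[A] A), x = S.convLeft f (S.convRight g c)}
  add_mem' := add_mem
  zero_mem' := zero_mem _
  smul_mem' a x hx := by
    refine AddSubgroup.closure_induction (fun x hx => ?_) ?_ (fun x y _ _ hx hy => ?_)
      (fun x _ hx => ?_) hx
    · obtain ⟨f, g, rfl⟩ := hx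
      exact AddSubgroup.subset_closure ⟨_, g, S.smul_convLeft a f _⟩
    · rw [smul_zero]; exact zero_mem _
    · rw [smul_add]; exact add_mem hx hy
    · rw [smul_neg]; exact neg_mem hx
  op_smul_mem' b x hx := by
    refine AddSubgroup.closure_induction (fun x hx => ?_) ?_ (fun x y _ _ hx hy => ?_)
      (fun x _ hx => ?_) hx
    · obtain ⟨f, g, rfl⟩ := hx
      refine AddSubgroup.subset_closure ⟨f, (rmul b).comp g, ?_⟩
      -- `L_f` is right linear, so the scalar passes through it and is absorbed into `g`.
      rw [← map_smul, op_smul_convRight]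
    · rw [smul_zero]; exact zero_mem _
    · rw [smul_add]; exact add_mem hx hy
    · rw [smul_neg]; exact neg_mem hx

theorem convLeft_convRight_mem_generated (f : C →ₗ[Aᵐᵒᵖ] A) (g : C →ₗ[A] A) (c : C) :
    S.convLeft f (S.convRight g c) ∈ S.generated c :=
  AddSubgroup.subset_closure ⟨f, g, rfl⟩

theorem mem_generated (c : C) : c ∈ S.generated c := by
  have h := S.convLeft_convRight_mem_generated S.counit.right S.counit.left c
  rwa [convRight_counit, convLeft_counit] at h

/-- On generators, `R_h` moves past `L_f` and merges with `R_g` into `R_{h ∘ R_g}`. -/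
theorem convRight_mem_generated (h : C →ₗ[A] A) {c x : C} (hx : x ∈ S.generated c) :
    S.convRight h x ∈ S.generated c := by
  refine AddSubgroup.closure_induction (fun x hx => ?_) ?_ (fun x y _ _ hx hy => ?_)
    (fun x _ hx => ?_) hx
  · obtain ⟨f, g, rfl⟩ := hx
    rw [convRight_convLeft, convRight_convRight]
    exact S.convLeft_convRight_mem_generated _ _ _
  · rw [map_zero]; exact zero_mem _
  · rw [map_add]; exact add_mem hx hy
  · rw [map_neg]; exact neg_mem hx

theorem convLeft_mem_generated (h : C →ₗ[Aᵐᵒᵖ] A) {c x : C} (hx : x ∈ S.generated c) :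
    S.convLeft h x ∈ S.generated c := by
  refine AddSubgroup.closure_induction (fun x hx => ?_) ?_ (fun x y _ _ hx hy => ?_)
    (fun x _ hx => ?_) hx
  · obtain ⟨f, g, rfl⟩ := hx
    rw [convLeft_convLeft]
    exact S.convLeft_convRight_mem_generated _ _ _
  · rw [map_zero]; exact zero_mem _
  · rw [map_add]; exact add_mem hx hy
  · rw [map_neg]; exact neg_mem hx

/-- Bimodule generators are the elements `L_{rᵢ}(R_{sⱼ} c)`: finitely many `j` suffice for `c`, and
then finitely many `i` for each `R_{sⱼ} c`. -/
theorem isFiniteType_generated {ι κ : Type*} {e : ι → C} {s : ι → C →ₗ[A] A}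
    (hs : IsLeftDualBasis e s) {d : κ → C} {r : κ → C →ₗ[Aᵐᵒᵖ] A} (hr : IsRightDualBasis d r)
    (c : C) : IsFiniteType A A (S.generated c) := by
  classical
  obtain ⟨F, hF⟩ := S.exists_convRight_eq_sum hs c
  choose G hG using fun j => S.exists_convLeft_eq_sum hr (S.convRight (s j) c)
  let y : ι → κ → S.generated c := fun j i =>
    ⟨_, S.convLeft_convRight_mem_generated (r i) (s j) c⟩
  refine ⟨F.biUnion fun j => (G j).image (y j), eq_top_iff.2 fun x _ => ?_⟩
  obtain ⟨x, hx⟩ := x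
  refine AddSubgroup.closure_induction
    (p := fun x _ => ∀ hx : x ∈ S.generated c, (⟨x, hx⟩ : S.generated c) ∈ AddSubgroup.closure _)
    (fun x hx hx' => ?_) (fun _ => zero_mem _)
    (fun x y hx hy hx' hy' _ => add_mem (hx' hx) (hy' hy))
    (fun x hx hx' _ => neg_mem (hx' hx)) hx hx
  obtain ⟨f, g, rfl⟩ := hx
  -- Expand `R_g c` first, pull `g(eⱼ)` out by right linearity of `L_f`, then expand `L_f`.
  have key : (⟨_, hx'⟩ : S.generated c) = ∑ j ∈ F, ∑ i ∈ G j,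
      f (d i) • MulOpposite.op (g (e j)) • y j i := by
    apply Subtype.ext
    simp only [AddSubmonoidClass.coe_finsetSum]
    rw [hF g, map_sum]
    refine Finset.sum_congr rfl fun j _ => ?_
    rw [map_smul, hG j f, Finset.smul_sum]
    exact Finset.sum_congr rfl fun i _ => (smul_comm _ _ _).symm
  rw [key]
  refine sum_mem fun j hj => sum_mem fun i hi => AddSubgroup.subset_closure ?_
  exact ⟨y j i, Finset.mem_biUnion.2 ⟨j, hj, Finset.mem_image_of_mem _ hi⟩, _, _, rfl⟩

end Coring

end Convolution

end CoringTheory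

namespace CoringTheory

open Tensor

/-! ### Factoring bimodule maps through injections -/

namespace BimoduleHom

variable {A X Y Z : Type*} [Ring A] [AddCommGroup X] [Module A X] [Module Aᵐᵒᵖ X]
  [AddCommGroup Y] [Module A Y] [Module Aᵐᵒᵖ Y] [AddCommGroup Z] [Module A Z] [Module Aᵐᵒᵖ Z]

/-- The identity of a bimodule. -/
def id (A X : Type*) [Ring A] [AddCommGroup X] [Module A X] [Module Aᵐᵒᵖ X] :
    BimoduleHom A X X where
  toLinearMap := LinearMap.id
  map_op_smul' _ _ := rfl

/-- The composition of bimodule maps. -/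
def comp (g : BimoduleHom A Y Z) (f : BimoduleHom A X Y) : BimoduleHom A X Z where
  toLinearMap := g.left.comp f.left
  map_op_smul' b x := (congrArg g (f.map_op_smul' b x)).trans (g.map_op_smul' b (f x))

/-- A bimodule map whose values lie in the range of an injective bimodule map factors through
it. -/
theorem exists_lift (f : BimoduleHom A X Y) (hf : Function.Injective f) (g : BimoduleHom A Z Y)
    (h : ∀ z, ∃ x, f x = g z) : ∃ u : BimoduleHom A Z X, ∀ z, f (u z) = g z := by
  choose u hu using h
  refine ⟨⟨⟨⟨u, fun x y => hf ?_⟩, fun a x => hf ?_⟩, fun b x => hf ?_⟩, hu⟩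
  · exact (hu _).trans ((g.map_add' x y).trans
      ((congrArg₂ (· + ·) (hu x) (hu y)).symm.trans (f.map_add' _ _).symm))
  · exact (hu _).trans ((g.map_smul' a x).trans
      ((congrArg (a • ·) (hu x)).symm.trans (f.map_smul' a _).symm))
  · exact (hu _).trans ((g.map_op_smul' b x).trans
      ((congrArg (b • ·) (hu x)).symm.trans (f.map_op_smul' b _).symm))

end BimoduleHom

namespace Tensor

variable {A M N M' N' : Type*} [Ring A] [AddCommGroup M] [AddCommGroup N]
  [AddCommGroup M'] [AddCommGroup N']
  [Module A M] [Module Aᵐᵒᵖ M] [SMulCommClass A Aᵐᵒᵖ M]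
  [Module A N] [Module Aᵐᵒᵖ N] [SMulCommClass A Aᵐᵒᵖ N]
  [Module A M'] [Module Aᵐᵒᵖ M'] [SMulCommClass A Aᵐᵒᵖ M']
  [Module A N'] [Module Aᵐᵒᵖ N'] [SMulCommClass A Aᵐᵒᵖ N']

/-- The map `f ⊗_A g` as a map of bimodules. -/
def mapBimodule (f : BimoduleHom A M M') (g : BimoduleHom A N N') :
    BimoduleHom A (Tensor A M N) (Tensor A M' N') where
  toLinearMap := mapLeft f g.left
  map_op_smul' b t := (mapRight f.right g).map_smul b t

end Tensor

/-! ### From stability to bicomodule structure -/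

namespace Coring

variable {A C : Type*} [Ring A] [AddCommGroup C] [Module A C] [Module Aᵐᵒᵖ C]
  [SMulCommClass A Aᵐᵒᵖ C] (S : Coring A C)

/-- If `C` is projective on both sides, a sub-bimodule closed under all operators
`c ↦ ∑ c₁ · g(c₂)` and `c ↦ ∑ f(c₁) · c₂` is a subbicomodule. -/
theorem isSubbicomodule_of_conv_mem {ι κ : Type*} {e : ι → C} {s : ι → C →ₗ[A] A}
    (hs : IsLeftDualBasis e s) {d : κ → C} {r : κ → C →ₗ[Aᵐᵒᵖ] A} (hr : IsRightDualBasis d r)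
    (D : SubBimodule A C) (hright : ∀ g, ∀ x ∈ D, S.convRight g x ∈ D)
    (hleft : ∀ f, ∀ x ∈ D, S.convLeft f x ∈ D) : S.IsSubbicomodule D := by
  have hiR : Function.Injective D.incl.right := Subtype.val_injective
  have hiL : Function.Injective D.incl.left := Subtype.val_injective
  have hDC : Function.Injective (map D.incl.right (LinearMap.id : C →ₗ[A] C)) :=
    hs.map_injective hiR
  have hCD : Function.Injective (map (LinearMap.id : C →ₗ[Aᵐᵒᵖ] C) D.incl.left) :=
    hr.map_injective hiL
  -- The coordinates of `Δ(x)` along `sⱼ` are `R_{sⱼ}(x)`, which lie in `D`; hence `Δ(x)` comes from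
  -- `D ⊗ C`.
  obtain ⟨ρ, hρ⟩ := (mapBimodule D.incl (BimoduleHom.id A C)).exists_lift hDC
    (S.comul.comp D.incl)
    (fun x => hs.mem_range_map fun j => ⟨⟨_, hright (s j) x x.2⟩, rfl⟩)
  obtain ⟨l, hl⟩ := (mapBimodule (BimoduleHom.id A C) D.incl).exists_lift hCD
    (S.comul.comp D.incl)
    (fun x => hr.mem_range_map fun j => ⟨⟨_, hleft (r j) x x.2⟩, rfl⟩)
  replace hρ : ∀ x : D, map D.incl.right LinearMap.id (ρ x) = S.comul (x : C) := hρ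
  replace hl : ∀ x : D, map LinearMap.id D.incl.left (l x) = S.comul (x : C) := hl
  have hρR : (mapRight D.incl.right (BimoduleHom.id A C)).comp ρ.right =
    S.comul.right.comp D.incl.right := LinearMap.ext hρ
  have hρL : (mapLeft D.incl LinearMap.id).comp ρ.left =
    S.comul.left.comp D.incl.left := LinearMap.ext hρ
  have hlR : (mapRight LinearMap.id D.incl).comp l.right =
    S.comul.right.comp D.incl.right := LinearMap.ext hl
  have hlL : (mapLeft (BimoduleHom.id A C) D.incl.left).comp l.left =
    S.comul.left.comp D.incl.left := LinearMap.ext hl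
  refine ⟨⟨ρ, l, fun x => ?_, fun x => ?_, fun x => ?_, fun x => ?_, fun x => ?_⟩,
    fun x => (hρ x).symm, fun x => (hl x).symm⟩
  -- Each axiom is tested after an injection induced by the inclusion, where it becomes the matching
  -- axiom of `Δ`. Here the target is `C ⊗ (C ⊗ C)`.
  · refine hs.map_tensor_injective hDC ?_
    have h := assoc_map D.incl.right (BimoduleHom.id A C) (LinearMap.id : C →ₗ[A] C)
      (map ρ.right LinearMap.id (ρ x))
    rw [map_map, hρR] at h
    have h2 := map_map S.comul.right (LinearMap.id : C →ₗ[A] C) D.incl.right LinearMap.id (ρ x)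
    rw [hρ] at h2
    have h3 := map_map (LinearMap.id : C →ₗ[Aᵐᵒᵖ] C) S.comul.left D.incl.right
      LinearMap.id (ρ x)
    rw [hρ] at h3
    have h4 : mapLeft (BimoduleHom.id A C) (LinearMap.id : C →ₗ[A] C) = LinearMap.id :=
      LinearMap.ext map_id_id
    rw [h4] at h
    rw [map_map]
    refine h.symm.trans ((congrArg _ h2.symm).trans ((S.coassoc _).trans h3))
  -- The counit identity lives in `D ⊗ A`, which embeds in `C ⊗ A`.
  · refine isLeftDualBasis_self.map_injective hiR ?_
    have h3 := map_map (LinearMap.id : C →ₗ[Aᵐᵒᵖ] C) S.counit.left D.incl.right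
      LinearMap.id (ρ x)
    rw [hρ, S.id_counit_comul] at h3
    rw [map_map]
    exact h3.symm
  · refine hr.map_injective (f := mapLeft (BimoduleHom.id A C) D.incl.left) hCD ?_
    have h := assoc_map (LinearMap.id : C →ₗ[Aᵐᵒᵖ] C) (BimoduleHom.id A C) D.incl.left
      (map S.comul.right LinearMap.id (l x))
    have h4 : mapRight (LinearMap.id : C →ₗ[Aᵐᵒᵖ] C) (BimoduleHom.id A C) = LinearMap.id :=
      LinearMap.ext map_id_id
    rw [map_map, h4] at h
    have h2 := map_map S.comul.right (LinearMap.id : C →ₗ[A] C) LinearMap.id D.incl.left (l x)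
    rw [hl] at h2
    have h3 := map_map LinearMap.id (mapLeft (BimoduleHom.id A C) D.incl.left)
      (LinearMap.id : C →ₗ[Aᵐᵒᵖ] C) l.left (l x)
    rw [hlL] at h3
    have h5 := map_map (LinearMap.id : C →ₗ[Aᵐᵒᵖ] C) S.comul.left LinearMap.id
      D.incl.left (l x)
    rw [hl] at h5
    exact h.symm.trans ((congrArg _ h2.symm).trans ((S.coassoc _).trans (h5.trans h3.symm)))
  · refine isRightDualBasis_self.map_injective hiL ?_
    have h3 := map_map S.counit.right (LinearMap.id : C →ₗ[A] C) LinearMap.id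
      D.incl.left (l x)
    rw [hl, S.counit_id_comul] at h3
    rw [map_map]
    exact h3.symm
  -- Flatness is used twice to embed `C ⊗ (D ⊗ C)`: on the right for `D ⊗ C`, then on the left.
  · refine hr.map_injective (f := mapLeft D.incl (LinearMap.id : C →ₗ[A] C)) hDC ?_
    have h := assoc_map (LinearMap.id : C →ₗ[Aᵐᵒᵖ] C) D.incl (LinearMap.id : C →ₗ[A] C)
      (map l.right LinearMap.id (ρ x))
    rw [map_map, hlR] at h
    have h2 := map_map S.comul.right (LinearMap.id : C →ₗ[A] C) D.incl.right LinearMap.id (ρ x)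
    rw [hρ] at h2
    have h5 := map_map (LinearMap.id : C →ₗ[Aᵐᵒᵖ] C) S.comul.left LinearMap.id
      D.incl.left (l x)
    rw [hl] at h5
    have h3 := map_map LinearMap.id (mapLeft D.incl (LinearMap.id : C →ₗ[A] C))
      (LinearMap.id : C →ₗ[Aᵐᵒᵖ] C) ρ.left (l x)
    rw [hρL] at h3
    exact h.symm.trans ((congrArg _ h2.symm).trans ((S.coassoc _).trans (h5.trans h3.symm)))

end Coring

theorem isFiniteType_of_isFiniteType_subBimodule {A M : Type*} [Ring A] [AddCommGroup M]
    [Module A M] [Module Aᵐᵒᵖ M] {D : SubBimodule A M} (hD : (D : Set M) = Set.univ)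
    (h : IsFiniteType A A D) : IsFiniteType A A M := by
  classical
  obtain ⟨s, hs⟩ := h
  refine ⟨s.image Subtype.val, eq_top_iff.2 fun x _ => ?_⟩
  have hx : x ∈ D := by
    rw [← SetLike.mem_coe, hD]
    trivial
  have hx' : (⟨x, hx⟩ : D) ∈ AddSubgroup.closure
      {x : D | ∃ m ∈ s, ∃ (r b : A), x = r • MulOpposite.op b • m} := hs ▸ AddSubgroup.mem_top _
  refine AddSubgroup.closure_induction (p := fun (y : D) _ => (y : M) ∈ AddSubgroup.closure _)
    (fun y hy => ?_) (zero_mem _) (fun y z _ _ hy hz => add_mem hy hz)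
    (fun y _ hy => neg_mem hy) hx'
  obtain ⟨m, hm, a, b, rfl⟩ := hy
  exact AddSubgroup.subset_closure ⟨m, Finset.mem_image_of_mem _ hm, a, b, rfl⟩

end CoringTheory

/-! ### The main theorem -/

theorem mainTheorem7 {k A C : Type*} [CommRing k] [Ring A] [Algebra k A]
    [AddCommGroup C] [Module k C] [Module A C] [Module Aᵐᵒᵖ C]
    [SMulCommClass A Aᵐᵒᵖ C] [IsScalarTower k A C] [IsScalarTower k Aᵐᵒᵖ C]
    (S : CoringTheory.Coring A C)
    (hleft : Module.Projective A C) (hright : Module.Projective Aᵐᵒᵖ C) :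
    (∃ F : Set (CoringTheory.SubBimodule A C),
      (∀ D ∈ F, S.IsSubbicomodule D ∧ CoringTheory.IsFiniteType A A D) ∧
      (⋃ D ∈ F, (D : Set C)) = Set.univ) ∧
    (S.IsSimple → CoringTheory.IsFiniteType A A C) := by
  obtain ⟨s, hs⟩ := CoringTheory.Tensor.exists_isLeftDualBasis hleft
  obtain ⟨r, hr⟩ := CoringTheory.Tensor.exists_isRightDualBasis hright
  have hsub (c : C) : S.IsSubbicomodule (S.generated c) :=
    S.isSubbicomodule_of_conv_mem hs hr _ (fun g _ hx => S.convRight_mem_generated g hx)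
      (fun f _ hx => S.convLeft_mem_generated f hx)
  have hfin (c : C) : CoringTheory.IsFiniteType A A (S.generated c) :=
    S.isFiniteType_generated hs hr c
  refine ⟨⟨Set.range S.generated, ?_, ?_⟩, fun hsimple => ?_⟩
  · rintro _ ⟨c, rfl⟩
    exact ⟨hsub c, hfin c⟩
  · exact Set.eq_univ_of_forall fun c => Set.mem_biUnion ⟨c, rfl⟩ (S.mem_generated c)
  -- `IsSimple` allows `C = 0`, which the empty set generates.
  · rcases subsingleton_or_nontrivial C with hC | hC
    · exact ⟨∅, Subsingleton.elim _ _⟩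
    · obtain ⟨c, hc⟩ := exists_ne (0 : C)
      rcases hsimple _ (hsub c) with h | h
      · have hmem : c ∈ (S.generated c : Set C) := S.mem_generated c
        rw [h] at hmem
        exact absurd hmem hc
      · exact CoringTheory.isFiniteType_of_isFiniteType_subBimodule h (hfin c)
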